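/- For $x,y\in\{0,1\}^n$ let $\mathrm{HAM}(x,y)$ be the number of positions in which $x$ and $y$ differ, and for $0\le a\le n$ let $\mathrm{HAM}_n^{(=a)}:\{0,1\}^n\times\{0,1\}^n\to\{0,1\}$ be the function with $\mathrm{HAM}_n^{(=a)}(x,y)=1$ if $\mathrm{HAM}(x,y)=a$, and $0$ otherwise. For $f:\{0,1\}^n\times\{0,1\}^n\to\{0,1\}$, where Alice is given $x$ and Bob is given $y$ and at the end both have to know $f(x,y)$, let - $D(f)$ be the minimum, over all deterministic two-party protocols (decision trees) computing $f$, of the number of bits transmitted in the worst case; - $C^*(f)$ be the minimum, over all error-free quantum protocols computing $f$ in which Alice and Bob start with any (finite, unlimited) number of shared EPR pairs and any number of private qubits in state $|0\rangle$, operate and measure locally, and communicate over a classical channel, of the number of classical bits transmitted in the worst case; - $Q^*(f)$ be the minimum, over all error-free quantum protocols computing $f$ in which Alice and Bob start with any (finite, unlimited) number of shared EPR pairs and any number of private qubits in state $|0\rangle$, operate locally, and communicate over a quantum channel in an order of speaking fixed by the protocol, of the number of qubits transmitted. Here error-free means that on every input pair $(x,y)$ both players output $f(x,y)$ with probability $1$.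 **Theorem.** There is an $N$ such that for all $n\ge N$ and all $0\le a\le n$: 1. $D\bigl(\mathrm{HAM}_n^{(=a)}\bigr)\ge n-2$; 2. $Q^*\bigl(\mathrm{HAM}_n^{(=a)}\bigr)\ge \frac n2-1$; 3. $C^*\bigl(\mathrm{HAM}_n^{(=a)}\bigr)\ge n-2$. -/

import Mathlib

open scoped Matrix

namespace CommComplexity

/-- Strings of `n` bits. They are the inputs of the players, and they also label the standard basis
of a register of `n` qubits. -/
abbrev Bits (n : ℕ) : Type := Fin n → Bool

/-- The exact-distance function: output `1` (`true`) iff the Hamming distance of the two strings is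
exactly `a`. -/
def hamEq (n a : ℕ) (x y : Bits n) : Bool := decide (hammingDist x y = a)

section Deterministic

/-- Deterministic two-party protocols, as decision trees. At an inner node the named player sends one
bit, a function of his or her own input (and of the node, that is, of the bits sent so far); a leaf
carries the common output of both players. -/
inductive DetProtocol (X Y : Type) : Type
  | output (z : Bool) : DetProtocol X Y
  | alice (msg : X → Bool) (next : Bool → DetProtocol X Y) : DetProtocol X Y
  | bob (msg : Y → Bool) (next : Bool → DetProtocol X Y) : DetProtocol X Y

variable {X Y : Type}

/-- The output of a deterministic protocol on an input pair. -/
def DetProtocol.eval : DetProtocol X Y → X → Y → Bool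
  | .output z, _, _ => z
  | .alice msg next, x, y => (next (msg x)).eval x y
  | .bob msg next, x, y => (next (msg y)).eval x y

/-- The number of bits transmitted in the worst case: the height of the tree. -/
def DetProtocol.cost : DetProtocol X Y → ℕ
  | .output _ => 0
  | .alice _ next => max (next false).cost (next true).cost + 1
  | .bob _ next => max (next false).cost (next true).cost + 1

/-- The protocol computes `f`. -/
def DetProtocol.Computes (P : DetProtocol X Y) (f : X → Y → Bool) : Prop :=
  ∀ x y, P.eval x y = f x y

end Deterministic

section Quantum

/-- A (possibly unnormalized) joint pure state of `a` qubits held by Alice and `b` qubits held by Bob: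
`ψ u v` is the amplitude of the basis vector `|u⟩ ⊗ |v⟩`. In this matrix form the local operators
`K ⊗ 1` and `1 ⊗ L` send `ψ` to `K * ψ` and to `ψ * Lᵀ`. -/
abbrev State (a b : ℕ) : Type := Matrix (Bits a) (Bits b) ℂ

/-- Squared norm of a joint state. -/
noncomputable def normSq {a b : ℕ} (ψ : State a b) : ℝ := ∑ u, ∑ v, ‖ψ u v‖ ^ 2

/-- A two-outcome quantum measurement on `k` qubits, given by its measurement operators. On the state
`ψ`, outcome `c` has probability `‖op c ψ‖²` and leaves the (unnormalized) state `op c ψ`. -/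
structure Measurement (k : ℕ) : Type where
  op : Bool → Matrix (Bits k) (Bits k) ℂ
  complete : ∑ c, (op c)ᴴ * op c = 1

/-- The initial state: `m` shared EPR pairs `(|00⟩ + |11⟩)/√2`, formed by the first `m` qubits of
Alice and the first `m` qubits of Bob, together with `kA` and `kB` private qubits, all `|0⟩`. -/
noncomputable def eprState (m kA kB : ℕ) : State (m + kA) (m + kB) := Matrix.of fun u v =>
  if (∀ i : Fin m, u (Fin.castAdd kA i) = v (Fin.castAdd kB i)) ∧
      (∀ j : Fin kA, u (Fin.natAdd m j) = false) ∧ (∀ j : Fin kB, v (Fin.natAdd m j) = false)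
  then ((1 / Real.sqrt 2 : ℝ) : ℂ) ^ m else 0

/-- Quantum protocols over a classical channel, for Alice holding `a` qubits and Bob holding `b`
qubits. At an inner node the named player measures his or her own qubits, the measurement depending on
his or her own input (and on the node, that is, on the bits sent so far), and sends the outcome, one
classical bit. At a leaf each of the two players obtains his or her output by a local measurement. -/
inductive ClassicalChannelProtocol (X Y : Type) (a b : ℕ) : Type
  | output (MA : X → Measurement a) (MB : Y → Measurement b) : ClassicalChannelProtocol X Y a b
  | alice (M : X → Measurement a) (next : Bool → ClassicalChannelProtocol X Y a b) :
      ClassicalChannelProtocol X Y a b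
  | bob (M : Y → Measurement b) (next : Bool → ClassicalChannelProtocol X Y a b) :
      ClassicalChannelProtocol X Y a b

/-- Quantum protocols over a quantum channel, from the point where Alice holds `a` qubits and Bob
holds `b` qubits. In a step the named player applies to his or her own qubits a unitary depending on
his or her own input, and sends one of these qubits (the first) to the other player, where it becomes
the first qubit. At the end each of the two players obtains his or her output by a local measurement.
The players may speak in any order, which is fixed by the protocol. -/
inductive QuantumChannelProtocol (X Y : Type) : ℕ → ℕ → Type
  | output {a b : ℕ} (MA : X → Measurement a) (MB : Y → Measurement b) :
      QuantumChannelProtocol X Y a b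
  | alice {a b : ℕ} (U : X → Matrix.unitaryGroup (Bits (a + 1)) ℂ)
      (next : QuantumChannelProtocol X Y a (b + 1)) : QuantumChannelProtocol X Y (a + 1) b
  | bob {a b : ℕ} (U : Y → Matrix.unitaryGroup (Bits (b + 1)) ℂ)
      (next : QuantumChannelProtocol X Y (a + 1) b) : QuantumChannelProtocol X Y a (b + 1)

/-- The first qubit of Alice is handed over and becomes the first qubit of Bob. -/
def sendToBob {a b : ℕ} (ψ : State (a + 1) b) : State a (b + 1) := Matrix.of fun u v =>
  ψ (Fin.cons (v 0) u : Bits (a + 1)) (Fin.tail v)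

/-- The first qubit of Bob is handed over and becomes the first qubit of Alice. -/
def sendToAlice {a b : ℕ} (ψ : State a (b + 1)) : State (a + 1) b := Matrix.of fun u v =>
  ψ (Fin.tail u) (Fin.cons (u 0) v : Bits (b + 1))

variable {X Y : Type}

/-- On inputs `x`, `y` and from the state `ψ`, the probability that Alice outputs `zA` and Bob outputs
`zB` (summed over all transcripts). -/
noncomputable def ClassicalChannelProtocol.prob {a b : ℕ} (x : X) (y : Y) (zA zB : Bool) :
    ClassicalChannelProtocol X Y a b → State a b → ℝ
  | .output MA MB, ψ => normSq ((MA x).op zA * ψ * ((MB y).op zB)ᵀ)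
  | .alice M next, ψ => ∑ c : Bool, (next c).prob x y zA zB ((M x).op c * ψ)
  | .bob M next, ψ => ∑ c : Bool, (next c).prob x y zA zB (ψ * ((M y).op c)ᵀ)

/-- The number of classical bits transmitted in the worst case: the height of the tree. -/
def ClassicalChannelProtocol.cost {a b : ℕ} : ClassicalChannelProtocol X Y a b → ℕ
  | .output _ _ => 0
  | .alice _ next => max (next false).cost (next true).cost + 1
  | .bob _ next => max (next false).cost (next true).cost + 1

/-- On inputs `x`, `y` and from the state `ψ`, the probability that Alice outputs `zA` and Bob outputs
`zB`. -/
noncomputable def QuantumChannelProtocol.prob (x : X) (y : Y) (zA zB : Bool) :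
    {a b : ℕ} → QuantumChannelProtocol X Y a b → State a b → ℝ
  | _, _, .output MA MB, ψ => normSq ((MA x).op zA * ψ * ((MB y).op zB)ᵀ)
  | _, _, .alice U next, ψ => next.prob x y zA zB (sendToBob ((U x).val * ψ))
  | _, _, .bob U next, ψ => next.prob x y zA zB (sendToAlice (ψ * ((U y).val)ᵀ))

/-- The number of qubits transmitted. -/
def QuantumChannelProtocol.cost : {a b : ℕ} → QuantumChannelProtocol X Y a b → ℕ
  | _, _, .output _ _ => 0
  | _, _, .alice _ next => next.cost + 1
  | _, _, .bob _ next => next.cost + 1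

/-- Started on `m` EPR pairs and private qubits `|0⟩`, the protocol computes `f` without error: on
every input pair, with probability one, both players output `f x y`. -/
def ClassicalChannelProtocol.Computes {m kA kB : ℕ}
    (P : ClassicalChannelProtocol X Y (m + kA) (m + kB)) (f : X → Y → Bool) : Prop :=
  ∀ x y, P.prob x y (f x y) (f x y) (eprState m kA kB) = 1

/-- Started on `m` EPR pairs and private qubits `|0⟩`, the protocol computes `f` without error: on
every input pair, with probability one, both players output `f x y`. -/
def QuantumChannelProtocol.Computes {m kA kB : ℕ}
    (P : QuantumChannelProtocol X Y (m + kA) (m + kB)) (f : X → Y → Bool) : Prop :=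
  ∀ x y, P.prob x y (f x y) (f x y) (eprState m kA kB) = 1

end Quantum

section Complexity

variable {n : ℕ}

/-- The costs of the deterministic protocols for `f`. -/
def detCosts (f : Bits n → Bits n → Bool) : Set ℕ :=
  {c | ∃ P : DetProtocol (Bits n) (Bits n), P.Computes f ∧ P.cost = c}

/-- The costs of the error-free quantum protocols for `f` over a classical channel, with any number
`m` of shared EPR pairs and any numbers `kA`, `kB` of private qubits. -/
def classicalChannelCosts (f : Bits n → Bits n → Bool) : Set ℕ :=
  {c | ∃ (m kA kB : ℕ) (P : ClassicalChannelProtocol (Bits n) (Bits n) (m + kA) (m + kB)),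
    P.Computes f ∧ P.cost = c}

/-- The costs of the error-free quantum protocols for `f` over a quantum channel, with any number
`m` of shared EPR pairs and any numbers `kA`, `kB` of private qubits. -/
def quantumChannelCosts (f : Bits n → Bits n → Bool) : Set ℕ :=
  {c | ∃ (m kA kB : ℕ) (P : QuantumChannelProtocol (Bits n) (Bits n) (m + kA) (m + kB)),
    P.Computes f ∧ P.cost = c}

/-- `D(f)`: the number of bits transmitted in an optimal deterministic protocol for `f`. -/
noncomputable def D (f : Bits n → Bits n → Bool) : ℕ := sInf (detCosts f)

/-- `C*(f)`: the number of bits transmitted in an optimal error-free protocol for `f` with shared EPR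
pairs and a classical channel. -/
noncomputable def CStar (f : Bits n → Bits n → Bool) : ℕ := sInf (classicalChannelCosts f)

/-- `Q*(f)`: the number of qubits transmitted in an optimal error-free protocol for `f` with shared
EPR pairs and a quantum channel. -/
noncomputable def QStar (f : Bits n → Bits n → Bool) : ℕ := sInf (quantumChannelCosts f)

end Complexity

/-! The three minima are over non-empty sets. -/

section WellDefined

variable {n : ℕ}

lemma exists_det_aux (f : Bits n → Bits n → Bool) (l : List (Fin n)) :
    ∀ z : Bits n, ∃ P : DetProtocol (Bits n) (Bits n),
      ∀ x y, (∀ i, i ∈ l ∨ z i = x i) → P.eval x y = f x y := by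
  induction l with
  | nil =>
    intro z
    refine ⟨.bob (fun y => f z y) (fun b => .output b), fun x y h => ?_⟩
    have : z = x := funext fun i => by simpa using h i
    simp [DetProtocol.eval, this]
  | cons i l ih =>
    intro z
    choose P hP using ih
    refine ⟨.alice (fun x => x i) (fun b => P (Function.update z i b)), fun x y h => ?_⟩
    simp only [DetProtocol.eval]
    refine hP _ x y fun j => ?_
    by_cases hj : j = i
    · subst hj
      simp
    · simpa [hj] using h j

theorem detCosts_nonempty (f : Bits n → Bits n → Bool) : (detCosts f).Nonempty := by
  obtain ⟨P, hP⟩ := exists_det_aux f (List.finRange n) (fun _ => false)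
  exact ⟨_, P, fun x y => hP x y fun i => Or.inl (List.mem_finRange i), rfl⟩

/-- The measurement with the certain outcome `c`, which does not touch the qubits. -/
def constMeasurement (k : ℕ) (c : Bool) : Measurement k where
  op d := if d = c then 1 else 0
  complete := by cases c <;> simp

lemma exists_classicalChannel_aux {X Y : Type} {a b : ℕ} (P : DetProtocol X Y) :
    ∃ P' : ClassicalChannelProtocol X Y a b, ∀ x y ψ,
      P'.prob x y (P.eval x y) (P.eval x y) ψ = normSq ψ := by
  induction P with
  | output z =>
    refine ⟨.output (fun _ => constMeasurement a z) (fun _ => constMeasurement b z), ?_⟩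
    intro x y ψ
    simp [ClassicalChannelProtocol.prob, DetProtocol.eval, constMeasurement]
  | alice msg next ih =>
    choose P hP using ih
    have h0 : ∀ (Q : ClassicalChannelProtocol X Y a b) x y zA zB, Q.prob x y zA zB 0 = 0 := by
      intro Q x y zA zB
      induction Q with
      | output => simp [ClassicalChannelProtocol.prob, normSq]
      | alice M next ih => simp [ClassicalChannelProtocol.prob, ih]
      | bob M next ih => simp [ClassicalChannelProtocol.prob, ih]
    refine ⟨.alice (fun x => constMeasurement a (msg x)) P, ?_⟩
    intro x y ψ
    simp only [ClassicalChannelProtocol.prob, DetProtocol.eval, constMeasurement]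
    rw [Finset.sum_eq_single (msg x)]
    · simp [hP]
    · intro c _ hc
      simp [hc, h0]
    · simp
  | bob msg next ih =>
    choose P hP using ih
    have h0 : ∀ (Q : ClassicalChannelProtocol X Y a b) x y zA zB, Q.prob x y zA zB 0 = 0 := by
      intro Q x y zA zB
      induction Q with
      | output => simp [ClassicalChannelProtocol.prob, normSq]
      | alice M next ih => simp [ClassicalChannelProtocol.prob, ih]
      | bob M next ih => simp [ClassicalChannelProtocol.prob, ih]
    refine ⟨.bob (fun y => constMeasurement b (msg y)) P, ?_⟩
    intro x y ψ
    simp only [ClassicalChannelProtocol.prob, DetProtocol.eval, constMeasurement]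
    rw [Finset.sum_eq_single (msg y)]
    · simp [hP]
    · intro c _ hc
      simp [hc, h0]
    · simp

lemma eprState_zero (k l : ℕ) :
    eprState 0 k l = Matrix.single (fun _ => false) (fun _ => false) 1 := by
  ext u v
  have hu : (∀ j : Fin k, u (Fin.natAdd 0 j) = false) ↔ u = fun _ => false := by
    constructor
    · intro h
      funext i
      have := h (Fin.cast (by omega) i)
      rwa [show Fin.natAdd 0 (Fin.cast (by omega) i : Fin k) = i from Fin.ext (by simp)] at this
    · rintro rfl j
      rfl
  have hv : (∀ j : Fin l, v (Fin.natAdd 0 j) = false) ↔ v = fun _ => false := by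
    constructor
    · intro h
      funext i
      have := h (Fin.cast (by omega) i)
      rwa [show Fin.natAdd 0 (Fin.cast (by omega) i : Fin l) = i from Fin.ext (by simp)] at this
    · rintro rfl j
      rfl
  simp only [eprState, Matrix.of_apply, hu, hv, Matrix.single_apply, pow_zero]
  simp [eq_comm]

lemma normSq_single {a b : ℕ} (u : Bits a) (v : Bits b) :
    normSq (Matrix.single u v (1 : ℂ)) = 1 := by
  unfold normSq
  rw [Finset.sum_eq_single u, Finset.sum_eq_single v]
  · simp
  · intro w _ hw
    simp [hw.symm]
  · simp
  · intro w _ hw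
    simp [hw.symm]
  · simp

theorem classicalChannelCosts_nonempty (f : Bits n → Bits n → Bool) :
    (classicalChannelCosts f).Nonempty := by
  obtain ⟨_, P, hP, _⟩ := detCosts_nonempty f
  obtain ⟨P', hP'⟩ := exists_classicalChannel_aux (a := 0 + 0) (b := 0 + 0) P
  refine ⟨_, 0, 0, 0, P', fun x y => ?_, rfl⟩
  rw [← hP x y, hP', eprState_zero, normSq_single]

/-- The unitary that permutes the basis vectors by an involution. -/
def involutionUnitary {k : ℕ} (σ : Bits k → Bits k) (hσ : ∀ u, σ (σ u) = u) :
    Matrix.unitaryGroup (Bits k) ℂ :=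
  ⟨Matrix.of fun u v => if u = σ v then 1 else 0, by
    have hs : ∀ u v, u = σ v ↔ v = σ u := fun u v =>
      ⟨fun h => by rw [h, hσ], fun h => by rw [h, hσ]⟩
    rw [Matrix.mem_unitaryGroup_iff]
    ext u v
    rw [Matrix.mul_apply, Finset.sum_eq_single (σ u)]
    · simp [Matrix.star_apply, hσ, Matrix.one_apply, eq_comm]
    · intro w _ hw
      have : u ≠ σ w := fun h => hw ((hs u w).1 h)
      simp [this]
    · simp⟩

lemma involutionUnitary_mul_single {k b : ℕ} (σ : Bits k → Bits k) (hσ : ∀ u, σ (σ u) = u)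
    (u : Bits k) (v : Bits b) :
    (involutionUnitary σ hσ).val * Matrix.single u v (1 : ℂ) = Matrix.single (σ u) v (1 : ℂ) := by
  ext i j
  simp only [Matrix.mul_apply, involutionUnitary, Matrix.of_apply, Matrix.single_apply]
  rw [Finset.sum_eq_single u]
  · by_cases h1 : i = σ u <;> by_cases h2 : v = j <;> simp [h1, h2, eq_comm]
  · intro w _ hw
    simp [hw.symm]
  · simp

lemma single_mul_involutionUnitary {k a : ℕ} (σ : Bits k → Bits k) (hσ : ∀ u, σ (σ u) = u)
    (u : Bits a) (v : Bits k) :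
    Matrix.single u v (1 : ℂ) * ((involutionUnitary σ hσ).val)ᵀ = Matrix.single u (σ v) (1 : ℂ) := by
  rw [← Matrix.transpose_transpose (Matrix.single u v (1 : ℂ)), ← Matrix.transpose_mul,
    Matrix.transpose_single, involutionUnitary_mul_single, Matrix.transpose_single]

lemma sendToBob_single {a b : ℕ} (u : Bits (a + 1)) (v : Bits b) :
    sendToBob (Matrix.single u v (1 : ℂ)) =
      Matrix.single (Fin.tail u) (Fin.cons (u 0) v : Bits (b + 1)) (1 : ℂ) := by
  ext i j
  simp only [sendToBob, Matrix.of_apply, Matrix.single_apply]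
  congr 1
  have h1 : u = (Fin.cons (j 0) i : Bits (a + 1)) ↔ u 0 = j 0 ∧ Fin.tail u = i := by
    rw [← Fin.cons_self_tail u, Fin.cons_inj]
    simp
  have h2 : (Fin.cons (u 0) v : Bits (b + 1)) = j ↔ u 0 = j 0 ∧ v = Fin.tail j := by
    rw [← Fin.cons_self_tail j, Fin.cons_inj]
    simp
  rw [h1, h2, eq_iff_iff]
  tauto

lemma sendToAlice_single {a b : ℕ} (u : Bits a) (v : Bits (b + 1)) :
    sendToAlice (Matrix.single u v (1 : ℂ)) =
      Matrix.single (Fin.cons (v 0) u : Bits (a + 1)) (Fin.tail v) (1 : ℂ) := by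
  ext i j
  simp only [sendToAlice, Matrix.of_apply, Matrix.single_apply]
  congr 1
  have h1 : v = (Fin.cons (i 0) j : Bits (b + 1)) ↔ v 0 = i 0 ∧ Fin.tail v = j := by
    rw [← Fin.cons_self_tail v, Fin.cons_inj]
    simp
  have h2 : (Fin.cons (v 0) u : Bits (a + 1)) = i ↔ v 0 = i 0 ∧ u = Fin.tail i := by
    rw [← Fin.cons_self_tail i, Fin.cons_inj]
    simp
  rw [h1, h2, eq_iff_iff]
  tauto

/-- The measurement in the standard basis, followed by the computation of `g` on the result. -/
def basisMeasurement {k : ℕ} (g : Bits k → Bool) : Measurement k where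
  op c := Matrix.diagonal fun u => if g u = c then 1 else 0
  complete := by
    ext u v
    by_cases h : u = v
    · subst h
      cases hg : g u <;> simp [hg]
    · simp [h]

lemma basisMeasurement_apply {a b : ℕ} (g : Bits a → Bool) (h : Bits b → Bool) (u : Bits a)
    (v : Bits b) :
    (basisMeasurement g).op (g u) * Matrix.single u v (1 : ℂ) * ((basisMeasurement h).op (h v))ᵀ =
      Matrix.single u v (1 : ℂ) := by
  ext i j
  simp only [basisMeasurement, Matrix.diagonal_transpose, Matrix.mul_diagonal, Matrix.diagonal_mul,
    Matrix.single_apply]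
  by_cases h1 : u = i <;> by_cases h2 : v = j <;> simp [h1, h2]

lemma exists_quantumChannel_aux (f : Bits n → Bits n → Bool) (a : ℕ) :
    ∀ (b : ℕ) (h : Bits n → Bits b),
      (∀ x x', h x = h x' → (∀ i : Fin n, i.val < a → x i = x' i) → x = x') →
      ∃ P : QuantumChannelProtocol (Bits n) (Bits n) (a + 1) b, ∀ x y,
        P.prob x y (f x y) (f x y) (Matrix.single (fun _ => false) (h x) (1 : ℂ)) = 1 := by
  induction a with
  | zero =>
    intro b h hinj
    have hinj' : Function.Injective h := fun x x' hx =>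
      hinj x x' hx fun i hi => absurd hi (Nat.not_lt_zero _)
    let F : Bits n → Bits b → Bool := fun y w => f (Function.invFun h w) y
    have hF : ∀ x y, F y (h x) = f x y := fun x y => by
      simp [F, Function.leftInverse_invFun hinj' x]
    let σ : Bits n → Bits (b + 1) → Bits (b + 1) := fun y w =>
      Fin.cons (xor (w 0) (F y (Fin.tail w))) (Fin.tail w)
    have hσ : ∀ y w, σ y (σ y w) = w := fun y w => by
      simp [σ]
    refine ⟨.alice (fun _ => involutionUnitary id fun _ => rfl)
      (.bob (fun y => involutionUnitary (σ y) (hσ y))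
        (.output (fun _ => basisMeasurement fun u => u 0)
          (fun y => basisMeasurement (F y)))), fun x y => ?_⟩
    simp only [QuantumChannelProtocol.prob, involutionUnitary_mul_single, sendToBob_single,
      single_mul_involutionUnitary, sendToAlice_single]
    have key := basisMeasurement_apply (fun u : Bits (0 + 1) => u 0) (F y)
      (Fin.cons (f x y) (Fin.tail fun _ => false)) (h x)
    rw [hF] at key
    simp only [Fin.cons_zero] at key
    have hs : σ y (Fin.cons false (h x)) = Fin.cons (f x y) (h x) := by
      simp [σ, hF]
    simp only [id, hs, Fin.cons_zero, Fin.tail_cons]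
    erw [key]
    exact normSq_single _ _
  | succ a ih =>
    intro b h hinj
    let bit : Bits n → Bool := fun x => if ha : a < n then x ⟨a, ha⟩ else false
    obtain ⟨P, hP⟩ := ih (b + 1) (fun x => Fin.cons (bit x) (h x)) (by
      intro x x' hx hlt
      obtain ⟨hb, hh⟩ := Fin.cons_inj.1 hx
      refine hinj x x' hh fun i hi => ?_
      rcases Nat.lt_succ_iff_lt_or_eq.1 hi with hi | hi
      · exact hlt i hi
      · have ha : a < n := hi ▸ i.isLt
        have hia : i = ⟨a, ha⟩ := Fin.ext hi
        simpa [bit, ha, hia] using hb)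
    refine ⟨.alice (fun x => involutionUnitary
      (fun w => Fin.cons (xor (w 0) (bit x)) (Fin.tail w)) fun w => by simp) P, fun x y => ?_⟩
    simp only [QuantumChannelProtocol.prob, involutionUnitary_mul_single, sendToBob_single]
    have ht : Fin.tail (fun _ : Fin (a + 1 + 1) => false) = fun _ => false := rfl
    simpa [ht] using hP x y

theorem quantumChannelCosts_nonempty (f : Bits n → Bits n → Bool) :
    (quantumChannelCosts f).Nonempty := by
  obtain ⟨P, hP⟩ := exists_quantumChannel_aux f (0 + n) (0 + 0) (fun _ _ => false)
    (fun x x' _ h => funext fun i => h i (by simp))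
  refine ⟨_, 0, n + 1, 0, P, fun x y => ?_, rfl⟩
  rw [eprState_zero]
  exact hP x y

end WellDefined

end CommComplexity

/-! All three bounds come from the rank over ℂ of the communication matrix `M` of the function.
Lower bound on the rank: `M` depends only on the Hamming distance of its two arguments, so the
characters of the cube diagonalize it, and the eigenvalue at a set `S` is a Krawtchouk number
depending only on `S.card`. A three-term recurrence forbids two consecutive levels with eigenvalue
zero, and level 0 has eigenvalue `n.choose a`, which is nonzero. Levels of this kind carry at least
a third of the cube, so `2 ^ n ≤ 3 * M.rank` (`two_pow_le_three_mul_rank_hamEq`). Upper bounds: a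
deterministic protocol partitions `M` into at most `2 ^ D` blocks of rank at most one. For a quantum
protocol, summing the effects of the accepting transcripts gives an operator that is a sum of at
most `r` products of local operators, with `r = 2 ^ c` for `c` classical bits and `r = 4 ^ c` for
`c` qubits. Absence of error makes this operator act on the initial state as multiplication by `M x
y`. The EPR pairs are a scaled identity matrix, so the products of local operators become products
of matrices, and `M ⊗ 1` factors through a space only `r` times as large as the space of the
identity. The dimension of the entanglement cancels, leaving `M.rank ≤ r`
(`rank_le_of_isSumOfLocal`). -/

open Polynomial

namespace CommComplexity

/-! ### Nonvanishing of Krawtchouk numbers -/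

section Krawtchouk

/-- The Krawtchouk numbers, as coefficients of their generating polynomial. -/
noncomputable def krawtchouk (a p q : ℕ) : ℂ := ((1 - X) ^ p * (1 + X) ^ q : ℂ[X]).coeff a

/-- Differentiate `g = (1 - X) ^ (p + 1) * (1 + X) ^ (q + 1)`, multiply by `2 * X = (1 + X) - (1 -
X)`, and compare coefficients of `X ^ a`. The total degree is fixed, so this links three consecutive
levels. -/
lemma krawtchouk_recurrence (a p q : ℕ) :
    2 * a * krawtchouk a (p + 1) (q + 1) = (p + q + 2) * krawtchouk a (p + 1) (q + 1)
      - (p + 1) * krawtchouk a p (q + 2) - (q + 1) * krawtchouk a (p + 2) q := by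
  have hX : ∀ g : ℂ[X], (X * derivative g).coeff a = a * g.coeff a := by
    intro g
    cases a with
    | zero => simp
    | succ a => rw [coeff_X_mul, coeff_derivative]; push_cast; ring
  have key : C 2 * (X * derivative ((1 - X) ^ (p + 1) * (1 + X) ^ (q + 1) : ℂ[X])) =
      C ((p : ℂ) + q + 2) * ((1 - X) ^ (p + 1) * (1 + X) ^ (q + 1))
      - C ((p : ℂ) + 1) * ((1 - X) ^ p * (1 + X) ^ (q + 2))
      - C ((q : ℂ) + 1) * ((1 - X) ^ (p + 2) * (1 + X) ^ q) := by
    simp only [derivative_mul, derivative_pow, derivative_sub, derivative_one,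
      derivative_X, map_add, map_one, Nat.add_sub_cancel, Nat.cast_add, Nat.cast_one, map_natCast,
      show (C (2 : ℂ) : ℂ[X]) = 2 from rfl]
    ring
  have := congrArg (fun g : ℂ[X] => g.coeff a) key
  simp only [coeff_C_mul, coeff_sub, hX] at this
  unfold krawtchouk
  linear_combination this

/-- The recurrence pushes two consecutive zeros down one level, since the lowest term has the
nonzero coefficient `k + 1`. The descent ends at level 0, where the value is `n.choose a`. -/
lemma krawtchouk_consecutive_ne_zero {a n : ℕ} (ha : a ≤ n) (k : ℕ) (hk : k + 1 ≤ n) :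
    ¬ (krawtchouk a k (n - k) = 0 ∧ krawtchouk a (k + 1) (n - (k + 1)) = 0) := by
  induction k with
  | zero =>
    rintro ⟨h, -⟩
    rw [krawtchouk, pow_zero, one_mul, Nat.sub_zero, coeff_one_add_X_pow] at h
    exact (Nat.choose_pos ha).ne' (by exact_mod_cast h)
  | succ k ih =>
    rintro ⟨h1, h2⟩
    refine ih (by omega) ⟨?_, h1⟩
    obtain ⟨q, rfl⟩ : ∃ q, n = k + q + 2 := ⟨n - (k + 2), by omega⟩
    have hr := krawtchouk_recurrence a k q
    rw [show k + q + 2 - (k + 1) = q + 1 by omega] at h1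
    rw [show k + q + 2 - (k + 1 + 1) = q by omega] at h2
    rw [show k + q + 2 - k = q + 2 by omega]
    rw [h1, h2] at hr
    have : ((k : ℂ) + 1) * krawtchouk a k (q + 2) = 0 := by linear_combination hr
    exact (mul_eq_zero.1 this).resolve_left (by exact_mod_cast Nat.succ_ne_zero k)

/-- A set of levels of the cube that contains the bottom level and one of any two consecutive levels
carries at least a third of the points. -/
lemma two_pow_le_three_mul_sum_choose {n : ℕ} (p : ℕ → Prop) [DecidablePred p] (h0 : p 0)
    (h : ∀ k, k + 1 ≤ n → p k ∨ p (k + 1)) :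
    2 ^ n ≤ 3 * ∑ k ∈ (Finset.range (n + 1)).filter p, n.choose k := by
  set S := (Finset.range (n + 1)).filter p with hS
  set Z := (Finset.range (n + 1)).filter (fun k => ¬ p k) with hZ
  have hsplit : ∑ k ∈ S, n.choose k + ∑ k ∈ Z, n.choose k = 2 ^ n := by
    rw [Finset.sum_filter_add_sum_filter_not, Nat.sum_range_choose]
  have hpos : ∀ k, ¬ p k → 1 ≤ k := fun k hk => by
    rcases Nat.eq_zero_or_pos k with rfl | hk'
    · exact absurd h0 hk
    · exact hk'
  -- Away from the middle, the neighbour on the side of the middle is already large enough; at `n =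
  -- 2 * k` the two neighbours are equal and both are needed. The neighbours of a level in `Z` that
  -- lie within the cube belong to `S`, so summing gives at most twice the weight of `S`.
  have hbound : ∀ k ∈ Z, n.choose k ≤ n.choose (k - 1) + n.choose (k + 1) := by
    intro k hk
    simp only [hZ, Finset.mem_filter, Finset.mem_range] at hk
    obtain ⟨j, rfl⟩ := Nat.exists_eq_add_of_le' (hpos k hk.2)
    rw [Nat.add_sub_cancel]
    have h1 := Nat.choose_succ_right_eq n j
    have h2 := Nat.choose_succ_right_eq n (j + 1)
    rcases lt_trichotomy n (2 * (j + 1)) with hlt | heq | hgt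
    · refine (Nat.le_of_mul_le_mul_right ?_ (Nat.succ_pos j)).trans (Nat.le_add_right _ _)
      rw [Nat.succ_eq_add_one, h1]
      exact Nat.mul_le_mul_left _ (by omega)
    · have h3 : n.choose (j + 1 + 1) = n.choose j := by
        rw [← Nat.choose_symm (by omega : j ≤ n)]
        congr 1
        omega
      rw [h3, ← two_mul]
      refine Nat.le_of_mul_le_mul_right ?_ (Nat.succ_pos j)
      rw [Nat.succ_eq_add_one, h1, mul_comm 2, mul_assoc]
      exact Nat.mul_le_mul_left _ (by omega)
    · refine (Nat.le_of_mul_le_mul_right ?_ (Nat.succ_pos (j + 1))).trans (Nat.le_add_left _ _)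
      rw [Nat.succ_eq_add_one, h2]
      exact Nat.mul_le_mul_left _ (by omega)
  have hup : ∑ k ∈ Z, n.choose (k + 1) ≤ ∑ k ∈ S, n.choose k := by
    calc ∑ k ∈ Z, n.choose (k + 1) = ∑ k ∈ Z.image (fun k => k + 1), n.choose k := by
          rw [Finset.sum_image (by intro a _ b _ hab; simpa using hab)]
      -- The top level `n` may lie in `Z`; its upper neighbour `n + 1` has weight zero.
      _ ≤ ∑ k ∈ insert (n + 1) S, n.choose k := by
          refine Finset.sum_le_sum_of_subset fun k hk => ?_
          simp only [hZ, Finset.mem_image, Finset.mem_filter, Finset.mem_range] at hk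
          obtain ⟨j, ⟨hj1, hj2⟩, rfl⟩ := hk
          simp only [hS, Finset.mem_insert, Finset.mem_filter, Finset.mem_range]
          by_cases hj : j = n
          · exact Or.inl (by rw [hj])
          · exact Or.inr ⟨by omega, (h j (by omega)).resolve_left hj2⟩
      _ = ∑ k ∈ S, n.choose k := by
          rw [Finset.sum_insert (by simp [hS]), Nat.choose_succ_self, zero_add]
  have hdown : ∑ k ∈ Z, n.choose (k - 1) ≤ ∑ k ∈ S, n.choose k := by
    calc ∑ k ∈ Z, n.choose (k - 1) = ∑ k ∈ Z.image (fun k => k - 1), n.choose k := by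
          rw [Finset.sum_image]
          intro a ha b hb hab
          rw [Finset.mem_coe, hZ, Finset.mem_filter] at ha hb
          have := hpos a ha.2
          have := hpos b hb.2
          simp only at hab
          omega
      _ ≤ ∑ k ∈ S, n.choose k := by
          refine Finset.sum_le_sum_of_subset fun k hk => ?_
          simp only [hZ, Finset.mem_image, Finset.mem_filter, Finset.mem_range] at hk
          obtain ⟨j, ⟨hj1, hj2⟩, rfl⟩ := hk
          obtain ⟨i, rfl⟩ := Nat.exists_eq_add_of_le' (hpos j hj2)
          simp only [hS, Finset.mem_filter, Finset.mem_range, Nat.add_sub_cancel]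
          exact ⟨by omega, (h i (by omega)).resolve_right hj2⟩
  have hsum := Finset.sum_le_sum hbound
  rw [Finset.sum_add_distrib] at hsum
  omega

end Krawtchouk

/-! ### Spectrum of the exact-distance matrix and deterministic protocols -/

section Rank

variable {n : ℕ}

/-- The communication matrix. -/
def commMatrix {X Y : Type} (f : X → Y → Bool) : Matrix X Y ℂ :=
  Matrix.of fun x y => if f x y then 1 else 0

/-- The characters of the cube, as the rows of a matrix. -/
def character (n : ℕ) : Matrix (Finset (Fin n)) (Bits n) ℂ :=
  Matrix.of fun S x => ∏ i, if i ∈ S ∧ x i = true then -1 else 1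

/-- The sum over the cube factors over coordinates. A coordinate lying in exactly one of the two
sets contributes the factor `1 - 1 = 0`, every other one contributes `2`. -/
lemma character_mul_transpose : character n * (character n)ᵀ = (2 : ℂ) ^ n • 1 := by
  ext S T
  simp only [Matrix.mul_apply, character, Matrix.of_apply, Matrix.transpose_apply,
    ← Finset.prod_mul_distrib, Matrix.smul_apply, Matrix.one_apply, smul_eq_mul]
  rw [← Fintype.prod_sum (fun (i : Fin n) (b : Bool) =>
    (if i ∈ S ∧ b = true then (-1 : ℂ) else 1) * (if i ∈ T ∧ b = true then -1 else 1))]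
  by_cases h : S = T
  · subst h
    rw [if_pos rfl, mul_one, Finset.prod_congr rfl (g := fun _ => (2 : ℂ))]
    · simp
    · intro i _
      by_cases hi : i ∈ S <;> simp [hi, one_add_one_eq_two]
  · rw [if_neg h, mul_zero]
    obtain ⟨i, hi⟩ : ∃ i, ¬ (i ∈ S ↔ i ∈ T) := by
      by_contra! hc
      exact h (Finset.ext hc)
    refine Finset.prod_eq_zero (Finset.mem_univ i) ?_
    by_cases h1 : i ∈ S <;> by_cases h2 : i ∈ T <;> simp_all

/-- The sum again factors: flipping bit `i` costs a factor `X`, together with a sign if `i ∈ S`, so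
the factor is `1 + X` outside `S` and `±(1 - X)` inside. The signs collect to the character at `x`.
The coefficient of `X ^ a` is the eigenvalue equation for distance `a`. -/
lemma sum_character_mul_X_pow (S : Finset (Fin n)) (x : Bits n) :
    ∑ y, C (character n S y) * X ^ hammingDist x y =
      C (character n S x) * ((1 - X) ^ S.card * (1 + X) ^ (n - S.card) : ℂ[X]) := by
  have h1 : ∀ y : Bits n, C (character n S y) * X ^ hammingDist x y =
      ∏ i, (C (if i ∈ S ∧ y i = true then (-1 : ℂ) else 1) * if x i ≠ y i then X else 1) := by
    intro y
    rw [Finset.prod_mul_distrib, ← map_prod, Finset.prod_ite (p := fun i => x i ≠ y i),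
      Finset.prod_const, Finset.prod_const_one, mul_one]
    rfl
  have h2 : ((1 - X) ^ S.card * (1 + X) ^ (n - S.card) : ℂ[X]) =
      ∏ i : Fin n, if i ∈ S then 1 - X else 1 + X := by
    rw [Finset.prod_ite, Finset.prod_const, Finset.prod_const]
    congr 2
    · simp
    · rw [Finset.filter_not, Finset.card_sdiff]
      simp
  simp_rw [h1]
  rw [← Fintype.prod_sum (fun (i : Fin n) (b : Bool) =>
    C (if i ∈ S ∧ b = true then (-1 : ℂ) else 1) * if x i ≠ b then (X : ℂ[X]) else 1), h2]
  simp only [character, Matrix.of_apply]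
  rw [map_prod, ← Finset.prod_mul_distrib]
  refine Finset.prod_congr rfl fun i _ => ?_
  by_cases hi : i ∈ S <;> cases hx : x i <;> simp [hi] <;> ring

lemma commMatrix_hamEq_mul_character (a : ℕ) :
    commMatrix (hamEq n a) * (character n)ᵀ =
      (character n)ᵀ *
        (Matrix.diagonal fun S => krawtchouk a S.card (n - S.card) :
          Matrix (Finset (Fin n)) (Finset (Fin n)) ℂ) := by
  ext x S
  rw [Matrix.mul_diagonal, Matrix.mul_apply]
  have h := congrArg (fun g : ℂ[X] => g.coeff a) (sum_character_mul_X_pow S x)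
  simp only [finsetSum_coeff, coeff_C_mul, coeff_X_pow] at h
  rw [Matrix.transpose_apply, krawtchouk, ← h]
  refine Finset.sum_congr rfl fun y _ => ?_
  simp [commMatrix, hamEq, eq_comm]

theorem two_pow_le_three_mul_rank_hamEq {a : ℕ} (ha : a ≤ n) :
    2 ^ n ≤ 3 * (commMatrix (hamEq n a)).rank := by
  classical
  set D : Matrix (Finset (Fin n)) (Finset (Fin n)) ℂ :=
    Matrix.diagonal fun S => krawtchouk a S.card (n - S.card) with hD
  have h1 : D = (((2 : ℂ) ^ n)⁻¹ • character n) * commMatrix (hamEq n a) * (character n)ᵀ := by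
    rw [Matrix.mul_assoc, commMatrix_hamEq_mul_character, ← Matrix.mul_assoc, Matrix.smul_mul,
      character_mul_transpose, smul_smul, inv_mul_cancel₀ (pow_ne_zero _ two_ne_zero), one_smul, Matrix.one_mul]
  have h2 : D.rank ≤ (commMatrix (hamEq n a)).rank := by
    rw [h1]
    exact (Matrix.rank_mul_le_left _ _).trans (Matrix.rank_mul_le_right _ _)
  -- The rank of a diagonal matrix counts its nonzero entries; grouping the sets by cardinality
  -- turns this into a sum of binomial coefficients.
  have h3 : D.rank = ∑ k ∈ (Finset.range (n + 1)).filter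
      (fun k => krawtchouk a k (n - k) ≠ 0), n.choose k := by
    rw [hD, Matrix.rank_diagonal, Fintype.card_subtype, Finset.card_filter, ← Finset.powerset_univ,
      Finset.sum_powerset_apply_card (fun k => if krawtchouk a k (n - k) ≠ 0 then 1 else 0),
      Finset.card_univ, Fintype.card_fin, Finset.sum_filter]
    simp
  have h4 := two_pow_le_three_mul_sum_choose (n := n) (fun k => krawtchouk a k (n - k) ≠ 0)
    (by
      rw [krawtchouk, pow_zero, one_mul, Nat.sub_zero, coeff_one_add_X_pow]
      exact_mod_cast (Nat.choose_pos ha).ne')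
    (fun k hk => by
      have := krawtchouk_consecutive_ne_zero ha k hk
      tauto)
  omega

lemma rank_add_le {X Y : Type} [Fintype X] [Fintype Y] (A B : Matrix X Y ℂ) :
    (A + B).rank ≤ A.rank + B.rank := by
  unfold Matrix.rank
  rw [Matrix.mulVecLin_add]
  refine (Submodule.finrank_mono ?_).trans (Submodule.finrank_add_le_finrank_add_finrank _ _)
  rintro _ ⟨v, rfl⟩
  exact Submodule.add_mem_sup ⟨v, rfl⟩ ⟨v, rfl⟩

lemma two_pow_add_two_pow_le (c d : ℕ) : 2 ^ c + 2 ^ d ≤ 2 ^ (max c d + 1) := by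
  have h1 := Nat.pow_le_pow_right (n := 2) (by norm_num) (le_max_left c d)
  have h2 := Nat.pow_le_pow_right (n := 2) (by norm_num) (le_max_right c d)
  rw [pow_succ]
  omega

/-- A bit from Alice splits the rows into two classes and a bit from Bob splits the columns, so the
matrix is a sum of masked matrices of the two subtrees. A leaf is a constant matrix, of rank at most
one. -/
theorem DetProtocol.rank_eval_le {X Y : Type} [Fintype X] [Fintype Y] [DecidableEq X]
    [DecidableEq Y] (P : DetProtocol X Y) : (commMatrix P.eval).rank ≤ 2 ^ P.cost := by
  induction P with
  | output z =>
    have : commMatrix (DetProtocol.output (X := X) (Y := Y) z).eval =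
        Matrix.vecMulVec (fun _ => if z then (1 : ℂ) else 0) (fun _ => 1) := by
      ext x y
      cases z <;> simp [commMatrix, DetProtocol.eval, Matrix.vecMulVec_apply]
    rw [this]
    exact Matrix.rank_vecMulVec_le _ _
  | alice msg next ih =>
    have : commMatrix (DetProtocol.alice msg next).eval =
        Matrix.diagonal (fun x => if msg x then (0 : ℂ) else 1) * commMatrix (next false).eval +
        Matrix.diagonal (fun x => if msg x then (1 : ℂ) else 0) * commMatrix (next true).eval := by
      ext x y
      simp only [Matrix.add_apply, Matrix.diagonal_mul]
      cases h : msg x <;> simp [commMatrix, DetProtocol.eval, h]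
    rw [this]
    exact (rank_add_le _ _).trans ((add_le_add
      ((Matrix.rank_mul_le_right _ _).trans (ih false))
      ((Matrix.rank_mul_le_right _ _).trans (ih true))).trans (two_pow_add_two_pow_le _ _))
  | bob msg next ih =>
    have : commMatrix (DetProtocol.bob msg next).eval =
        commMatrix (next false).eval * Matrix.diagonal (fun y => if msg y then (0 : ℂ) else 1) +
        commMatrix (next true).eval * Matrix.diagonal (fun y => if msg y then (1 : ℂ) else 0) := by
      ext x y
      simp only [Matrix.add_apply, Matrix.mul_diagonal]
      cases h : msg y <;> simp [commMatrix, DetProtocol.eval, h]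
    rw [this]
    exact (rank_add_le _ _).trans ((add_le_add
      ((Matrix.rank_mul_le_left _ _).trans (ih false))
      ((Matrix.rank_mul_le_left _ _).trans (ih true))).trans (two_pow_add_two_pow_le _ _))

end Rank

/-! ### Sums of local operators and the rank bound -/

section LocalTerms

open scoped Kronecker

variable {X Y : Type}

/-- A family of linear maps on joint states that is a sum of at most `r` products of local
operators, the operators of Alice depending on `x` and those of Bob on `y`. -/
def IsSumOfLocal {m n m' n' : Type} [Fintype m] [Fintype n] (r : ℕ)
    (T : X → Y → Matrix m n ℂ → Matrix m' n' ℂ) : Prop :=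
  ∃ (ι : Type) (_ : Fintype ι) (A : ι → X → Matrix m' m ℂ) (B : ι → Y → Matrix n n' ℂ),
    Fintype.card ι ≤ r ∧ ∀ x y φ, T x y φ = ∑ i, A i x * φ * B i y

variable {m n m' n' m'' n'' : Type} [Fintype m] [Fintype n]

lemma IsSumOfLocal.mono {r s : ℕ} (h : r ≤ s) {T : X → Y → Matrix m n ℂ → Matrix m' n' ℂ}
    (hT : IsSumOfLocal r T) : IsSumOfLocal s T := by
  obtain ⟨ι, _, A, B, hc, hAB⟩ := hT
  exact ⟨ι, _, A, B, hc.trans h, hAB⟩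

lemma IsSumOfLocal.mul [DecidableEq m] [DecidableEq n] (A : X → Matrix m' m ℂ)
    (B : Y → Matrix n n' ℂ) : IsSumOfLocal 1 fun x y (φ : Matrix m n ℂ) => A x * φ * B y :=
  ⟨Unit, inferInstance, fun _ => A, fun _ => B, by simp, fun x y φ => by simp⟩

lemma IsSumOfLocal.add {r s : ℕ} {T S : X → Y → Matrix m n ℂ → Matrix m' n' ℂ}
    (hT : IsSumOfLocal r T) (hS : IsSumOfLocal s S) :
    IsSumOfLocal (r + s) fun x y φ => T x y φ + S x y φ := by
  obtain ⟨ι, _, A, B, hc, hAB⟩ := hT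
  obtain ⟨κ, _, C, D, hd, hCD⟩ := hS
  refine ⟨ι ⊕ κ, inferInstance, Sum.elim A C, Sum.elim B D, ?_, fun x y φ => ?_⟩
  · rw [Fintype.card_sum]
    omega
  · simp [hAB, hCD]

lemma IsSumOfLocal.comp [Fintype m'] [Fintype n'] {r s : ℕ} {S : X → Y → Matrix m' n' ℂ → Matrix m'' n'' ℂ}
    {T : X → Y → Matrix m n ℂ → Matrix m' n' ℂ} (hS : IsSumOfLocal s S) (hT : IsSumOfLocal r T) :
    IsSumOfLocal (s * r) fun x y φ => S x y (T x y φ) := by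
  obtain ⟨ι, _, A, B, hc, hAB⟩ := hT
  obtain ⟨κ, _, C, D, hd, hCD⟩ := hS
  refine ⟨κ × ι, inferInstance, fun p x => C p.1 x * A p.2 x, fun p y => B p.2 y * D p.1 y, ?_,
    fun x y φ => ?_⟩
  · rw [Fintype.card_prod]
    exact Nat.mul_le_mul hd hc
  · simp only
    rw [hCD, Fintype.sum_prod_type]
    refine Finset.sum_congr rfl fun j _ => ?_
    rw [hAB, Matrix.mul_sum, Matrix.sum_mul]
    exact Finset.sum_congr rfl fun i _ => by simp only [Matrix.mul_assoc]

/-- Keep the identity block of the rank normal form. In this form the rank survives a Kronecker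
product with an identity. -/
lemma exists_mul_mul_eq_one [Fintype X] [DecidableEq X] (M : Matrix X X ℂ) :
    ∃ (P : Matrix (Fin M.rank) X ℂ) (Q : Matrix X (Fin M.rank) ℂ), P * M * Q = 1 := by
  obtain ⟨V, U, e, -, -, h⟩ := Matrix.exists_rank_normal_form M
  refine ⟨V.submatrix (fun i => e.symm (Sum.inl i)) id,
    U.submatrix id (fun i => e.symm (Sum.inl i)), ?_⟩
  have h2 := congrArg (fun A : Matrix X X ℂ =>
    A.submatrix (fun i => e.symm (Sum.inl i)) (fun i => e.symm (Sum.inl i))) h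
  have h3 : (V.submatrix (fun i => e.symm (Sum.inl i)) id) * M *
      (U.submatrix id (fun i => e.symm (Sum.inl i))) =
        (V * M * U).submatrix (fun i => e.symm (Sum.inl i)) (fun i => e.symm (Sum.inl i)) := by
    ext i j
    simp [Matrix.mul_apply]
  refine h3.trans (h2.trans ?_)
  ext i j
  simp [Matrix.one_apply]

/-- If a sum of `r` products of local operators acts on the state `U V`, with `U` left invertible
and `V` right invertible, as multiplication by `f x y`, then `f` has rank at most `r`. -/
theorem rank_le_of_isSumOfLocal [Fintype X] [DecidableEq X] {ρ : Type} [Fintype ρ] [DecidableEq ρ]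
    [Nonempty ρ] {r : ℕ} {T : X → X → Matrix m n ℂ → Matrix m n ℂ} (hT : IsSumOfLocal r T)
    {M : Matrix X X ℂ} {U : Matrix m ρ ℂ} {V : Matrix ρ n ℂ} {U' : Matrix ρ m ℂ} {V' : Matrix n ρ ℂ}
    (hU : U' * U = 1) (hV : V * V' = 1) (h : ∀ x y, T x y (U * V) = M x y • (U * V)) :
    M.rank ≤ r := by
  obtain ⟨ι, _, A, B, hc, hAB⟩ := hT
  have h1 : ∀ x y, ∑ i, (U' * A i x * U) * (V * B i y * V') = M x y • (1 : Matrix ρ ρ ℂ) := by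
    intro x y
    calc ∑ i, (U' * A i x * U) * (V * B i y * V') = U' * (∑ i, A i x * (U * V) * B i y) * V' := by
          rw [Matrix.mul_sum, Matrix.sum_mul]
          exact Finset.sum_congr rfl fun i _ => by simp only [Matrix.mul_assoc]
      _ = M x y • ((U' * U) * (V * V')) := by
          rw [← hAB, h, Matrix.mul_smul, Matrix.smul_mul]
          simp only [Matrix.mul_assoc]
      _ = M x y • (1 : Matrix ρ ρ ℂ) := by rw [hU, hV, Matrix.one_mul]
  -- Stacking Alice's compressed operators in `F` and Bob's in `G` turns `h1` into a factorization
  -- of `M ⊗ 1` through `ι × ρ`. Hence `M.rank * card ρ ≤ card ι * card ρ`, and `card ρ` cancels.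
  let F : Matrix (X × ρ) (ι × ρ) ℂ := Matrix.of fun p q => (U' * A q.1 p.1 * U) p.2 q.2
  let G : Matrix (ι × ρ) (X × ρ) ℂ := Matrix.of fun q p => (V * B q.1 p.1 * V') q.2 p.2
  have h2 : F * G = M ⊗ₖ (1 : Matrix ρ ρ ℂ) := by
    ext ⟨x, u⟩ ⟨y, v⟩
    have := congrFun (congrFun (h1 x y) u) v
    rw [Matrix.sum_apply] at this
    rw [Matrix.mul_apply, Fintype.sum_prod_type, Matrix.kronecker_apply]
    simpa only [Matrix.mul_apply (M := U' * A _ x * U), F, G, Matrix.of_apply, Matrix.smul_apply,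
      smul_eq_mul] using this
  obtain ⟨P, Q, hPQ⟩ := exists_mul_mul_eq_one M
  have h3 : ((P ⊗ₖ (1 : Matrix ρ ρ ℂ)) * F) * (G * (Q ⊗ₖ (1 : Matrix ρ ρ ℂ))) = 1 := by
    rw [Matrix.mul_assoc, ← Matrix.mul_assoc F, h2, ← Matrix.mul_kronecker_mul,
      ← Matrix.mul_kronecker_mul, ← Matrix.mul_assoc, hPQ, Matrix.one_mul, Matrix.one_mul,
      Matrix.one_kronecker_one]
  have h4 : Fintype.card (Fin M.rank × ρ) ≤ Fintype.card (ι × ρ) := by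
    rw [← Matrix.rank_one (R := ℂ) (n := Fin M.rank × ρ), ← h3]
    exact (Matrix.rank_mul_le_left _ _).trans (Matrix.rank_le_card_width _)
  rw [Fintype.card_prod, Fintype.card_prod, Fintype.card_fin] at h4
  exact (Nat.le_of_mul_le_mul_right h4 Fintype.card_pos).trans hc

end LocalTerms

/-! ### Norms, measurements and the transfer of a qubit -/

section Norm

variable {a b : ℕ}

lemma normSq_nonneg (ψ : State a b) : 0 ≤ normSq ψ :=
  Finset.sum_nonneg fun _ _ => Finset.sum_nonneg fun _ _ => sq_nonneg _

lemma eq_zero_of_normSq_eq_zero {ψ : State a b} (h : normSq ψ = 0) : ψ = 0 := by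
  ext u v
  have h1 := (Finset.sum_eq_zero_iff_of_nonneg
    (fun u _ => Finset.sum_nonneg fun v _ => sq_nonneg ‖ψ u v‖)).1 h u (Finset.mem_univ u)
  have h2 := (Finset.sum_eq_zero_iff_of_nonneg (fun v _ => sq_nonneg ‖ψ u v‖)).1 h1 v
    (Finset.mem_univ v)
  simpa using h2

lemma normSq_transpose (ψ : State a b) : normSq (ψᵀ : State b a) = normSq ψ :=
  Finset.sum_comm

lemma normSq_eq_trace (ψ : State a b) : (normSq ψ : ℂ) = (ψᴴ * ψ).trace := by
  rw [← normSq_transpose]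
  simp only [normSq, Matrix.trace, Matrix.diag_apply, Matrix.mul_apply, Matrix.conjTranspose_apply,
    Matrix.transpose_apply, Complex.ofReal_sum]
  refine Finset.sum_congr rfl fun v _ => Finset.sum_congr rfl fun u _ => ?_
  rw [Complex.star_def, Complex.conj_mul', Complex.ofReal_pow]

lemma Measurement.sum_normSq (M : Measurement a) (ψ : State a b) :
    normSq (M.op true * ψ) + normSq (M.op false * ψ) = normSq ψ := by
  have h := M.complete
  rw [Fintype.sum_bool] at h
  have : ((normSq (M.op true * ψ) + normSq (M.op false * ψ) : ℝ) : ℂ) = normSq ψ := by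
    rw [Complex.ofReal_add, normSq_eq_trace, normSq_eq_trace, normSq_eq_trace, ← Matrix.trace_add]
    congr 1
    calc _ = ψᴴ * (((M.op true)ᴴ * M.op true + (M.op false)ᴴ * M.op false) * ψ) := by
          simp only [Matrix.conjTranspose_mul, Matrix.mul_assoc, Matrix.mul_add, Matrix.add_mul]
      _ = ψᴴ * ψ := by rw [h, Matrix.one_mul]
  exact_mod_cast this

lemma Measurement.sum_normSq_right (M : Measurement b) (ψ : State a b) :
    normSq (ψ * (M.op true)ᵀ) + normSq (ψ * (M.op false)ᵀ) = normSq ψ := by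
  rw [← normSq_transpose ψ, ← normSq_transpose (ψ * (M.op true)ᵀ),
    ← normSq_transpose (ψ * (M.op false)ᵀ), Matrix.transpose_mul, Matrix.transpose_mul,
    Matrix.transpose_transpose, Matrix.transpose_transpose]
  exact M.sum_normSq ψᵀ

lemma Measurement.normSq_right_le (M : Measurement b) (c : Bool) (ψ : State a b) :
    normSq (ψ * (M.op c)ᵀ) ≤ normSq ψ := by
  have h := M.sum_normSq_right ψ
  have h1 := normSq_nonneg (ψ * (M.op true)ᵀ)
  have h2 := normSq_nonneg (ψ * (M.op false)ᵀ)
  cases c <;> linarith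

lemma Measurement.normSq_le (M : Measurement a) (c : Bool) (ψ : State a b) :
    normSq (M.op c * ψ) ≤ normSq ψ := by
  have h := M.sum_normSq ψ
  have h1 := normSq_nonneg (M.op true * ψ)
  have h2 := normSq_nonneg (M.op false * ψ)
  cases c <;> linarith

lemma Measurement.recombine (M : Measurement a) (ψ : State a b) :
    (M.op true)ᴴ * (M.op true * ψ) + (M.op false)ᴴ * (M.op false * ψ) = ψ := by
  have h := M.complete
  rw [Fintype.sum_bool] at h
  rw [← Matrix.mul_assoc, ← Matrix.mul_assoc, ← Matrix.add_mul, h, Matrix.one_mul]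

lemma Measurement.recombine_right (M : Measurement b) (ψ : State a b) :
    ψ * (M.op true)ᵀ * ((M.op true)ᴴ)ᵀ + ψ * (M.op false)ᵀ * ((M.op false)ᴴ)ᵀ = ψ := by
  have h := congrArg Matrix.transpose (M.recombine ψᵀ)
  simpa [Matrix.transpose_mul] using h

/-- If both players certainly output `z`, the effect of Alice's outcome `1` is multiplication by
`z`. -/
lemma Measurement.effect_of_normSq_eq (MA : Measurement a) (MB : Measurement b) (z : Bool)
    (ψ : State a b) (h : normSq (MA.op z * ψ * (MB.op z)ᵀ) = normSq ψ) :
    (MA.op true)ᴴ * (MA.op true * ψ) = (if z then (1 : ℂ) else 0) • ψ := by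
  have h1 := MB.normSq_right_le z (MA.op z * ψ)
  have h2 := MA.sum_normSq ψ
  have h3 := MA.recombine ψ
  cases z with
  | false =>
    -- Bob's measurement cannot increase the norm, so Alice's outcome `z` already carries all of it
    -- and her other branch vanishes.
    have h0 : MA.op true * ψ = 0 := by
      refine eq_zero_of_normSq_eq_zero (le_antisymm ?_ (normSq_nonneg _))
      linarith
    simp [h0]
  | true =>
    have h0 : MA.op false * ψ = 0 := by
      refine eq_zero_of_normSq_eq_zero (le_antisymm ?_ (normSq_nonneg _))
      linarith
    rw [h0, Matrix.mul_zero, add_zero] at h3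
    simpa using h3

lemma normSq_unitary_mul (U : Matrix.unitaryGroup (Bits a) ℂ) (ψ : State a b) :
    normSq (U.val * ψ) = normSq ψ := by
  have h : ((normSq (U.val * ψ) : ℝ) : ℂ) = normSq ψ := by
    rw [normSq_eq_trace, normSq_eq_trace, Matrix.conjTranspose_mul, Matrix.mul_assoc,
      ← Matrix.mul_assoc U.valᴴ, ← Matrix.star_eq_conjTranspose U.val,
      Matrix.mem_unitaryGroup_iff'.1 U.2, Matrix.one_mul]
  exact_mod_cast h

lemma normSq_mul_unitary (U : Matrix.unitaryGroup (Bits b) ℂ) (ψ : State a b) :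
    normSq (ψ * U.valᵀ) = normSq ψ := by
  rw [← normSq_transpose ψ, ← normSq_transpose (ψ * U.valᵀ), Matrix.transpose_mul,
    Matrix.transpose_transpose]
  exact normSq_unitary_mul U ψᵀ

lemma normSq_sendToBob (ψ : State (a + 1) b) : normSq (sendToBob ψ) = normSq ψ := by
  have hcons : ∀ {k : ℕ} (F : Bits (k + 1) → ℝ),
      ∑ w, F w = ∑ c : Bool, ∑ u : Bits k, F (Fin.cons c u : Bits (k + 1)) := fun F => by
    rw [← (Fin.consEquiv fun _ => Bool).sum_comp, Fintype.sum_prod_type]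
    rfl
  unfold normSq sendToBob
  simp only [Matrix.of_apply]
  rw [hcons]
  simp_rw [hcons (fun v => ‖ψ (Fin.cons (v 0) _) (Fin.tail v)‖ ^ 2), Fin.cons_zero, Fin.tail_cons]
  exact Finset.sum_comm

lemma sendToAlice_sendToBob (ψ : State (a + 1) b) : sendToAlice (sendToBob ψ) = ψ := by
  ext u v
  simp [sendToAlice, sendToBob]

lemma sendToBob_sendToAlice (ψ : State a (b + 1)) : sendToBob (sendToAlice ψ) = ψ := by
  ext u v
  simp [sendToAlice, sendToBob]

lemma sendToBob_smul (c : ℂ) (ψ : State (a + 1) b) : sendToBob (c • ψ) = c • sendToBob ψ := rfl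

lemma sendToAlice_smul (c : ℂ) (ψ : State a (b + 1)) : sendToAlice (c • ψ) = c • sendToAlice ψ :=
  rfl

lemma sendToBob_transpose (ψ : State (a + 1) b) :
    (sendToBob ψ)ᵀ = sendToAlice (ψᵀ : State b (a + 1)) := rfl

lemma normSq_sendToAlice (ψ : State a (b + 1)) : normSq (sendToAlice ψ) = normSq ψ := by
  conv_rhs => rw [← sendToBob_sendToAlice ψ, normSq_sendToBob]

/-- One term for each value `c` of the transferred qubit: Alice applies `⟨c|` to her first qubit and
Bob adjoins `|c⟩`. -/
lemma isSumOfLocal_sendToBob {X Y : Type} :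
    IsSumOfLocal 2 fun (_ : X) (_ : Y) (ψ : State (a + 1) b) => sendToBob ψ := by
  refine ⟨Bool, inferInstance,
    fun c _ => Matrix.of fun u u' => if u' = (Fin.cons c u : Bits (a + 1)) then 1 else 0,
    fun c _ => Matrix.of fun v v' => if v' = (Fin.cons c v : Bits (b + 1)) then 1 else 0, by simp,
    fun _ _ ψ => ?_⟩
  ext u v
  have hv : ∀ c (w : Bits b), v = (Fin.cons c w : Bits (b + 1)) ↔ w = Fin.tail v ∧ c = v 0 := by
    intro c w
    rw [← Fin.cons_self_tail v, Fin.cons_inj]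
    simp only [Fin.cons_zero, Fin.tail_cons]
    tauto
  simp only [Matrix.sum_apply, Matrix.mul_apply, Matrix.of_apply, ite_mul, one_mul, zero_mul,
    Finset.sum_ite_eq', Finset.mem_univ, if_true, mul_ite, mul_one, mul_zero, hv, ite_and]
  simp [sendToBob]

lemma isSumOfLocal_sendToAlice {X Y : Type} :
    IsSumOfLocal 2 fun (_ : X) (_ : Y) (ψ : State a (b + 1)) => sendToAlice ψ := by
  obtain ⟨ι, _, A, B, hc, h⟩ := isSumOfLocal_sendToBob (X := Y) (Y := X) (a := b) (b := a)
  refine ⟨ι, _, fun i x => (B i x)ᵀ, fun i y => (A i y)ᵀ, hc, fun x y ψ => ?_⟩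
  have := congrArg Matrix.transpose (h y x ψᵀ)
  rw [sendToBob_transpose, Matrix.transpose_transpose, Matrix.transpose_sum] at this
  simpa [Matrix.transpose_mul, Matrix.mul_assoc] using this

end Norm

/-! ### Acceptance operators of quantum protocols -/

section Protocols

variable {X Y : Type}

/-- The acceptance operator of a protocol over a classical channel: the sum of the effects of the
transcripts on which Alice outputs `1`. -/
noncomputable def ClassicalChannelProtocol.accept {a b : ℕ} (x : X) (y : Y) :
    ClassicalChannelProtocol X Y a b → State a b → State a b
  | .output MA _, ψ => ((MA x).op true)ᴴ * ((MA x).op true * ψ)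
  | .alice M next, ψ => ((M x).op true)ᴴ * (next true).accept x y ((M x).op true * ψ) +
      ((M x).op false)ᴴ * (next false).accept x y ((M x).op false * ψ)
  | .bob M next, ψ => (next true).accept x y (ψ * ((M y).op true)ᵀ) * (((M y).op true)ᴴ)ᵀ +
      (next false).accept x y (ψ * ((M y).op false)ᵀ) * (((M y).op false)ᴴ)ᵀ

lemma isSumOfLocal_mul_left {a b c : ℕ} (A : X → Matrix (Bits c) (Bits a) ℂ) :
    IsSumOfLocal 1 fun x (_ : Y) (φ : State a b) => (A x * φ : State c b) := by
  simpa using IsSumOfLocal.mul A fun _ : Y => (1 : Matrix (Bits b) (Bits b) ℂ)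

lemma isSumOfLocal_mul_right {a b c : ℕ} (B : Y → Matrix (Bits b) (Bits c) ℂ) :
    IsSumOfLocal 1 fun (_ : X) y (φ : State a b) => (φ * B y : State a c) := by
  simpa using IsSumOfLocal.mul (fun _ : X => (1 : Matrix (Bits a) (Bits a) ℂ)) B

/-- Each transcript contributes a single product of local operators, and a tree of height `c` has at
most `2 ^ c` leaves. -/
lemma ClassicalChannelProtocol.isSumOfLocal_accept {a b : ℕ}
    (P : ClassicalChannelProtocol X Y a b) :
    IsSumOfLocal (2 ^ P.cost) fun x y φ => P.accept x y φ := by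
  induction P with
  | output MA MB =>
    exact (isSumOfLocal_mul_left fun x => ((MA x).op true)ᴴ).comp
      (isSumOfLocal_mul_left fun x => (MA x).op true)
  | alice M next ih =>
    have h : ∀ c, IsSumOfLocal (2 ^ (next c).cost) fun x y φ =>
        ((M x).op c)ᴴ * (next c).accept x y ((M x).op c * φ) := fun c =>
      ((isSumOfLocal_mul_left fun x => ((M x).op c)ᴴ).comp
        ((ih c).comp (isSumOfLocal_mul_left fun x => (M x).op c))).mono (by simp)
    refine ((h true).add (h false)).mono ?_
    rw [add_comm]
    exact two_pow_add_two_pow_le _ _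
  | bob M next ih =>
    have h : ∀ c, IsSumOfLocal (2 ^ (next c).cost) fun x y φ =>
        (next c).accept x y (φ * ((M y).op c)ᵀ) * (((M y).op c)ᴴ)ᵀ := fun c =>
      ((isSumOfLocal_mul_right fun y => (((M y).op c)ᴴ)ᵀ).comp
        ((ih c).comp (isSumOfLocal_mul_right fun y => ((M y).op c)ᵀ))).mono (by simp)
    refine ((h true).add (h false)).mono ?_
    rw [add_comm]
    exact two_pow_add_two_pow_le _ _

lemma ClassicalChannelProtocol.prob_le_normSq {a b : ℕ} (P : ClassicalChannelProtocol X Y a b)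
    (x : X) (y : Y) (zA zB : Bool) (ψ : State a b) : P.prob x y zA zB ψ ≤ normSq ψ := by
  induction P generalizing ψ with
  | output MA MB => exact ((MB y).normSq_right_le zB _).trans ((MA x).normSq_le zA ψ)
  | alice M next ih =>
    rw [prob, Fintype.sum_bool, ← (M x).sum_normSq ψ]
    exact add_le_add (ih _ _) (ih _ _)
  | bob M next ih =>
    rw [prob, Fintype.sum_bool, ← (M y).sum_normSq_right ψ]
    exact add_le_add (ih _ _) (ih _ _)

/-- No branch succeeds with more than its own weight, so certain success overall forces certain
success on both branches. Each then yields the same scalar, and completeness of the measurement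
reassembles the state. -/
lemma ClassicalChannelProtocol.accept_eq_smul {a b : ℕ} (P : ClassicalChannelProtocol X Y a b)
    (x : X) (y : Y) (z : Bool) (ψ : State a b) (h : P.prob x y z z ψ = normSq ψ) :
    P.accept x y ψ = (if z then (1 : ℂ) else 0) • ψ := by
  induction P generalizing ψ with
  | output MA MB => exact (MA x).effect_of_normSq_eq (MB y) z ψ h
  | alice M next ih =>
    rw [prob, Fintype.sum_bool, ← (M x).sum_normSq ψ] at h
    have h1 := (next true).prob_le_normSq x y z z ((M x).op true * ψ)
    have h2 := (next false).prob_le_normSq x y z z ((M x).op false * ψ)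
    rw [accept, ih true _ (by linarith), ih false _ (by linarith), Matrix.mul_smul, Matrix.mul_smul,
      ← smul_add, (M x).recombine ψ]
  | bob M next ih =>
    rw [prob, Fintype.sum_bool, ← (M y).sum_normSq_right ψ] at h
    have h1 := (next true).prob_le_normSq x y z z (ψ * ((M y).op true)ᵀ)
    have h2 := (next false).prob_le_normSq x y z z (ψ * ((M y).op false)ᵀ)
    rw [accept, ih true _ (by linarith), ih false _ (by linarith), Matrix.smul_mul, Matrix.smul_mul,
      ← smul_add, (M y).recombine_right ψ]

/-- The acceptance operator of a protocol over a quantum channel: the protocol is run, the effect of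
Alice's output `1` is applied, and the protocol is run backwards. -/
noncomputable def QuantumChannelProtocol.accept (x : X) (y : Y) :
    {a b : ℕ} → QuantumChannelProtocol X Y a b → State a b → State a b
  | _, _, .output MA _, ψ => ((MA x).op true)ᴴ * ((MA x).op true * ψ)
  | _, _, .alice U next, ψ =>
      ((U x).val)ᴴ * sendToAlice (next.accept x y (sendToBob ((U x).val * ψ)))
  | _, _, .bob U next, ψ =>
      sendToBob (next.accept x y (sendToAlice (ψ * ((U y).val)ᵀ))) * (((U y).val)ᴴ)ᵀ

/-- Every qubit is transferred twice, once in the run and once in its reversal, and each transfer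
doubles the number of terms; hence `4` per qubit, against `2` per classical bit. -/
lemma QuantumChannelProtocol.isSumOfLocal_accept {a b : ℕ} (P : QuantumChannelProtocol X Y a b) :
    IsSumOfLocal (4 ^ P.cost) fun x y φ => P.accept x y φ := by
  induction P with
  | output MA MB =>
    exact (isSumOfLocal_mul_left fun x => ((MA x).op true)ᴴ).comp
      (isSumOfLocal_mul_left fun x => (MA x).op true)
  | alice U next ih =>
    have h := (isSumOfLocal_mul_left fun x => ((U x).val)ᴴ).comp (isSumOfLocal_sendToAlice.comp
      (ih.comp (isSumOfLocal_sendToBob.comp (isSumOfLocal_mul_left fun x => (U x).val))))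
    refine h.mono (le_of_eq ?_)
    rw [cost, pow_succ]
    ring
  | bob U next ih =>
    have h := (isSumOfLocal_mul_right fun y => (((U y).val)ᴴ)ᵀ).comp (isSumOfLocal_sendToBob.comp
      (ih.comp (isSumOfLocal_sendToAlice.comp (isSumOfLocal_mul_right fun y => ((U y).val)ᵀ))))
    refine h.mono (le_of_eq ?_)
    rw [cost, pow_succ]
    ring

lemma QuantumChannelProtocol.prob_le_normSq {a b : ℕ} (P : QuantumChannelProtocol X Y a b)
    (x : X) (y : Y) (zA zB : Bool) (ψ : State a b) : P.prob x y zA zB ψ ≤ normSq ψ := by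
  induction P with
  | output MA MB => exact ((MB y).normSq_right_le zB _).trans ((MA x).normSq_le zA ψ)
  | alice U next ih =>
    refine (ih _).trans_eq ?_
    rw [normSq_sendToBob, normSq_unitary_mul]
  | bob U next ih =>
    refine (ih _).trans_eq ?_
    rw [normSq_sendToAlice, normSq_mul_unitary]

lemma QuantumChannelProtocol.accept_eq_smul {a b : ℕ} (P : QuantumChannelProtocol X Y a b)
    (x : X) (y : Y) (z : Bool) (ψ : State a b) (h : P.prob x y z z ψ = normSq ψ) :
    P.accept x y ψ = (if z then (1 : ℂ) else 0) • ψ := by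
  induction P with
  | output MA MB => exact (MA x).effect_of_normSq_eq (MB y) z ψ h
  | alice U next ih =>
    rw [accept, ih _ (by rw [normSq_sendToBob, normSq_unitary_mul]; exact h), sendToAlice_smul,
      sendToAlice_sendToBob, Matrix.mul_smul, ← Matrix.mul_assoc,
      ← Matrix.star_eq_conjTranspose (U x).val, Matrix.mem_unitaryGroup_iff'.1 (U x).2,
      Matrix.one_mul]
  | bob U next ih =>
    rw [accept, ih _ (by rw [normSq_sendToAlice, normSq_mul_unitary]; exact h), sendToBob_smul,
      sendToBob_sendToAlice, Matrix.smul_mul, Matrix.mul_assoc, ← Matrix.transpose_mul,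
      ← Matrix.star_eq_conjTranspose (U y).val, Matrix.mem_unitaryGroup_iff'.1 (U y).2,
      Matrix.transpose_one, Matrix.mul_one]

end Protocols

/-! ### EPR pairs and the final bounds -/

section Entanglement

variable {m : ℕ}

/-- The isometry that adds `k` qubits in state `|0⟩` to `m` qubits. -/
def padding (m k : ℕ) : Matrix (Bits (m + k)) (Bits m) ℂ :=
  Matrix.of fun u w => if u = (Fin.append w fun _ => false : Bits (m + k)) then 1 else 0

lemma padding_transpose_mul (m k : ℕ) : (padding m k)ᵀ * padding m k = 1 := by
  ext w w'
  have : (Fin.append w (fun _ => false) : Bits (m + k)) = Fin.append w' (fun _ => false) ↔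
      w = w' := by
    refine ⟨fun h => funext fun i => ?_, fun h => by rw [h]⟩
    simpa using congrFun h (Fin.castAdd k i)
  rw [Matrix.mul_apply, Finset.sum_eq_single (Fin.append w fun _ => false : Bits (m + k))]
  · simp [padding, Matrix.one_apply, this]
  · intro u _ hu
    simp [padding, hu]
  · simp

/-- In matrix form the EPR pairs are a scalar multiple of the identity, and the private qubits only
pad it by isometries. This supplies the one-sided inverses that `rank_le_of_isSumOfLocal` needs. -/
lemma eprState_eq (m kA kB : ℕ) : eprState m kA kB =
    (((1 / Real.sqrt 2 : ℝ) : ℂ) ^ m) • (padding m kA * (padding m kB)ᵀ) := by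
  ext u v
  have happ : ∀ {k : ℕ} (u : Bits (m + k)) (w : Bits m),
      u = (Fin.append w fun _ => false : Bits (m + k)) ↔
        w = (fun i => u (Fin.castAdd k i)) ∧ ∀ j : Fin k, u (Fin.natAdd m j) = false := by
    intro k u w
    constructor
    · rintro rfl
      exact ⟨funext fun i => by simp, fun j => by simp⟩
    · rintro ⟨rfl, h⟩
      funext i
      refine Fin.addCases (fun i => by simp) (fun j => by simp [h]) i
  simp only [eprState, Matrix.of_apply, Matrix.smul_apply, Matrix.mul_apply, padding,
    Matrix.transpose_apply, happ, smul_eq_mul]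
  by_cases hu : ∀ j : Fin kA, u (Fin.natAdd m j) = false
  · by_cases hv : ∀ j : Fin kB, v (Fin.natAdd m j) = false
    · simp only [hu, hv, ← funext_iff, implies_true, and_true]
      simp
      exact if_congr eq_comm rfl rfl
    · simp [hu, hv]
  · simp [hu]

lemma normSq_eprState (m kA kB : ℕ) : normSq (eprState m kA kB) = 1 := by
  have hs : ((padding m kB)ᵀ)ᴴ = padding m kB := by
    ext u w
    simp [padding, apply_ite]
  have hs' : (padding m kA)ᴴ = (padding m kA)ᵀ := by
    ext u w
    simp [padding, apply_ite]
  have hc : star (((1 / Real.sqrt 2 : ℝ) : ℂ) ^ m) * ((1 / Real.sqrt 2 : ℝ) : ℂ) ^ m =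
      ((2 : ℂ) ^ m)⁻¹ := by
    rw [star_pow, Complex.star_def, Complex.conj_ofReal, ← mul_pow, ← Complex.ofReal_mul,
      one_div, ← mul_inv, Real.mul_self_sqrt (by norm_num), ← inv_pow]
    norm_num
  have h : ((normSq (eprState m kA kB) : ℝ) : ℂ) = 1 := by
    rw [normSq_eq_trace, eprState_eq, Matrix.conjTranspose_smul, Matrix.smul_mul, Matrix.mul_smul,
      smul_smul, hc, Matrix.conjTranspose_mul, hs, hs', Matrix.mul_assoc,
      ← Matrix.mul_assoc (padding m kA)ᵀ, padding_transpose_mul, Matrix.one_mul, Matrix.trace_smul,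
      Matrix.trace_mul_comm, padding_transpose_mul, Matrix.trace_one]
    simp
  exact_mod_cast h

lemma rank_le_of_acts_on_eprState {X : Type} [Fintype X] [DecidableEq X] {m kA kB r : ℕ}
    {T : X → X → State (m + kA) (m + kB) → State (m + kA) (m + kB)} (hT : IsSumOfLocal r T)
    {M : Matrix X X ℂ} (h : ∀ x y, T x y (eprState m kA kB) = M x y • eprState m kA kB) :
    M.rank ≤ r := by
  have hc : ((1 / Real.sqrt 2 : ℝ) : ℂ) ^ m ≠ 0 :=
    pow_ne_zero _ (Complex.ofReal_ne_zero.2 (by positivity))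
  refine rank_le_of_isSumOfLocal (U := ((1 / Real.sqrt 2 : ℝ) : ℂ) ^ m • padding m kA)
    (V := (padding m kB)ᵀ) (U' := (((1 / Real.sqrt 2 : ℝ) : ℂ) ^ m)⁻¹ • (padding m kA)ᵀ)
    (V' := padding m kB) hT ?_ (padding_transpose_mul m kB) ?_
  · rw [Matrix.smul_mul, Matrix.mul_smul, smul_smul, inv_mul_cancel₀ hc, one_smul,
      padding_transpose_mul]
  · rw [Matrix.smul_mul, ← eprState_eq]
    exact h

variable {n : ℕ} {f : Bits n → Bits n → Bool}

theorem rank_le_two_pow_D : (commMatrix f).rank ≤ 2 ^ D f := by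
  obtain ⟨P, hP, hc⟩ := Nat.sInf_mem (detCosts_nonempty f)
  have hf : P.eval = f := funext fun x => funext fun y => hP x y
  rw [D, ← hc, ← hf]
  exact P.rank_eval_le

theorem rank_le_two_pow_CStar : (commMatrix f).rank ≤ 2 ^ CStar f := by
  obtain ⟨m, kA, kB, P, hP, hc⟩ := Nat.sInf_mem (classicalChannelCosts_nonempty f)
  rw [CStar, ← hc]
  exact rank_le_of_acts_on_eprState P.isSumOfLocal_accept fun x y =>
    P.accept_eq_smul x y (f x y) _ ((hP x y).trans (normSq_eprState m kA kB).symm)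

theorem rank_le_four_pow_QStar : (commMatrix f).rank ≤ 4 ^ QStar f := by
  obtain ⟨m, kA, kB, P, hP, hc⟩ := Nat.sInf_mem (quantumChannelCosts_nonempty f)
  rw [QStar, ← hc]
  exact rank_le_of_acts_on_eprState P.isSumOfLocal_accept fun x y =>
    P.accept_eq_smul x y (f x y) _ ((hP x y).trans (normSq_eprState m kA kB).symm)

/-- The constant 3 costs less than two bits: `3 * 2 ^ c < 2 ^ (c + 2)`. -/
lemma le_succ_of_two_pow_le {r c : ℕ} (h : 2 ^ n ≤ 3 * r) (hr : r ≤ 2 ^ c) : n ≤ c + 1 := by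
  by_contra! hlt
  have := Nat.pow_le_pow_right (n := 2) (by norm_num) (show c + 2 ≤ n by omega)
  have := Nat.pow_pos (n := c) (show 0 < 2 by norm_num)
  rw [pow_add] at *
  omega

end Entanglement

end CommComplexity

theorem theorem5p12 :
    ∃ N : ℕ, ∀ n : ℕ, N ≤ n → ∀ a : ℕ, a ≤ n →
      (n : ℝ) - 2 ≤ (CommComplexity.D (CommComplexity.hamEq n a) : ℝ) ∧
      (n : ℝ) / 2 - 1 ≤ (CommComplexity.QStar (CommComplexity.hamEq n a) : ℝ) ∧
      (n : ℝ) - 2 ≤ (CommComplexity.CStar (CommComplexity.hamEq n a) : ℝ) := by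
  -- The rank bound holds for every `n`, so no threshold is needed; the bounds obtained, `n ≤ D +
  -- 1`, `n ≤ C* + 1` and `n ≤ 2 Q* + 1`, are slightly stronger than required.
  refine ⟨0, fun n _ a ha => ?_⟩
  have hr := CommComplexity.two_pow_le_three_mul_rank_hamEq ha
  have hD := CommComplexity.le_succ_of_two_pow_le hr CommComplexity.rank_le_two_pow_D
  have hC := CommComplexity.le_succ_of_two_pow_le hr CommComplexity.rank_le_two_pow_CStar
  have hQ := CommComplexity.le_succ_of_two_pow_le (c := 2 * CommComplexity.QStar (CommComplexity.hamEq n a)) hr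
    (CommComplexity.rank_le_four_pow_QStar.trans_eq (by rw [pow_mul]; norm_num))
  have hD' : (n : ℝ) ≤ CommComplexity.D (CommComplexity.hamEq n a) + 1 := by exact_mod_cast hD
  have hC' : (n : ℝ) ≤ CommComplexity.CStar (CommComplexity.hamEq n a) + 1 := by exact_mod_cast hC
  have hQ' : (n : ℝ) ≤ 2 * CommComplexity.QStar (CommComplexity.hamEq n a) + 1 := by
    exact_mod_cast hQ
  exact ⟨by linarith, by linarith, by linarith⟩
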